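/- **Theorem (connectivity of $G^m(n,p)$).** For $n\ge 1$, $m\ge 1$ and $p\in[0,1]$ let $G(n,p)$ denote the Erdős–Rényi random graph on the vertex set $\{1,\dots,n\}$, in which each of the $\binom n2$ possible edges is present independently with probability $p$, and let $G^m(n,p)$ denote the union of $m$ independent copies of $G(n,p)$ (two vertices are adjacent in $G^m(n,p)$ if and only if they are adjacent in at least one of the $m$ copies). Let $c\in\mathbb R$ be a constant and let $m=m(n)\ge 1$ be any sequence of positive integers (for example a constant one). If $p=p(n)\in[0,1]$ satisfies $$p=\frac{\log n+c}{mn}$$ for all sufficiently large $n$, then $$\lim_{n\to\infty}\mathbb P\bigl(G^m(n,p)\text{ is connected}\bigr)=e^{-e^{-c}}.$$ -/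

import Mathlib

open MeasureTheory ProbabilityTheory Filter Topology unitInterval

namespace SimpleGraph

/-- The law `G^m(V, p)` of the union of `m` independent Erdős–Rényi (binomial) random graphs on the
vertex set `V`, each with edge probability `p`: two vertices are adjacent in the union when they are
adjacent in at least one of the `m` graphs. -/
noncomputable def unionBinomialRandom (V : Type*) (m : ℕ) (p : I) : Measure (SimpleGraph V) :=
  (Measure.pi fun _ : Fin m ↦ binomialRandom V p).map fun g ↦ ⨆ k, g k

/-- Taking the union of `m` graphs is measurable, so that the push-forward in
`unionBinomialRandom` is the genuine law of the union. -/
lemma measurable_iSup_graph {V : Type*} (m : ℕ) :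
    Measurable fun g : Fin m → SimpleGraph V ↦ ⨆ k, g k := by
  refine measurable_comap_iff.2 (measurable_pi_iff.2 fun u ↦ measurable_pi_iff.2 fun v ↦ ?_)
  simp only [Function.comp_apply, iSup_adj]
  refine Measurable.exists fun k ↦ ?_
  have h : Measurable fun G : SimpleGraph V ↦ G.Adj u v :=
    (measurable_pi_apply v).comp ((measurable_pi_apply u).comp (comap_measurable _))
  exact h.comp (measurable_pi_apply k)

instance {V : Type*} [Countable V] (m : ℕ) (p : I) :
    IsProbabilityMeasure (unionBinomialRandom V m p) :=
  Measure.isProbabilityMeasure_map (measurable_iSup_graph m).aemeasurable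

end SimpleGraph

/-! Potential edges are absent from the union independently, each with probability q = (1 - p)^m, so
only q matters. The hypothesis on p gives q → 1 and n q^n → e^{-c}.

Connectedness fails in the limit only through isolated vertices. Inclusion–exclusion writes the
probability of having none as an alternating sum of C(n,k) q^(k(n-k) + C(k,2)). The k-th term tends
to (-1)^k e^{-ck}/k!, and these limits add up to exp(-e^{-c}).

A disconnected graph without isolated vertices has a set of k vertices, 2 ≤ k ≤ n/2, that no edge
leaves and that spans an edge. The union bound is a sum of C(n,k) q^(k(n-k)) (1 - q^C(k,2)), whose
terms tend to 0.

Both limits pass through the sum by dominated convergence, with the common bound e^{kD}/√(k!) from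
`choose_mul_pow_le`. -/

namespace SimpleGraph

/-! ### Probability that a given set of edges is absent -/

section Avoidance

variable {V : Type*}

lemma measurableSet_of_finite_vertices [Finite V] (s : Set (SimpleGraph V)) : MeasurableSet s := by
  have h : MeasurableSet (edgeSet '' s) := (Set.toFinite _).measurableSet
  rw [← Set.preimage_image_eq s edgeSet_injective]
  exact measurable_edgeSet h

/-- Diagonal pairs are never edges, so they would contribute a factor 1 instead of 1 - p; `hE`
excludes them. -/
lemma binomialRandom_avoids [Countable V] (p : I) (E : Finset (Sym2 V))
    (hE : ∀ e ∈ E, ¬ e.IsDiag) :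
    (binomialRandom V p) {G | ∀ e ∈ E, e ∉ G.edgeSet} = (toNNReal (σ p) : ENNReal) ^ E.card := by
  have hms : MeasurableSet {s : Set (Sym2 V) | ∀ e ∈ E, e ∉ s} := by
    have : {s : Set (Sym2 V) | ∀ e ∈ E, e ∉ s} = ⋂ e ∈ E, {s : Set (Sym2 V) | e ∉ s} := by
      ext; simp
    rw [this]
    exact Finset.measurableSet_biInter _ fun e _ ↦ (measurable_set_notMem e).setOf
  have hpre : fromEdgeSet ⁻¹' {G : SimpleGraph V | ∀ e ∈ E, e ∉ G.edgeSet} =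
      {s | ∀ e ∈ E, e ∉ s} := by
    ext s
    simp only [Set.mem_preimage, Set.mem_ofPred_eq, edgeSet_fromEdgeSet]
    exact forall₂_congr fun e he ↦ by simp [hE e he]
  have hmg : MeasurableSet {G : SimpleGraph V | ∀ e ∈ E, e ∉ G.edgeSet} :=
    measurable_edgeSet hms
  rw [binomialRandom_eq_map, Measure.map_apply measurable_fromEdgeSet hmg, hpre,
    setBernoulli_apply']
  have : (fun p : Sym2 V → Prop ↦ {i | p i}) ⁻¹' {s | ∀ e ∈ E, e ∉ s} =
      Set.pi (E : Set (Sym2 V)) fun _ ↦ {False} := by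
    ext f
    simp [Set.mem_pi]
  rw [this, Measure.infinitePi_pi _ (fun _ _ ↦ measurableSet_singleton _)]
  rw [Finset.prod_eq_pow_card]
  intro e he
  simp [hE e he]

lemma unionBinomialRandom_real_avoids [Finite V] (m : ℕ) (p : I) (E : Finset (Sym2 V))
    (hE : ∀ e ∈ E, ¬ e.IsDiag) :
    (unionBinomialRandom V m p).real {G | ∀ e ∈ E, e ∉ G.edgeSet} =
      ((1 - (p : ℝ)) ^ m) ^ E.card := by
  have hpre : (fun g : Fin m → SimpleGraph V ↦ ⨆ k, g k) ⁻¹' {G | ∀ e ∈ E, e ∉ G.edgeSet} =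
      Set.pi Set.univ fun _ ↦ {G | ∀ e ∈ E, e ∉ G.edgeSet} := by
    ext g
    simp only [Set.mem_preimage, Set.mem_ofPred_eq, Set.mem_pi, Set.mem_univ, true_implies]
    constructor
    · intro h k e he hk
      exact h e he (edgeSet_mono (le_iSup g k) hk)
    · intro h e he
      induction e with | _ u v =>
      simp only [mem_edgeSet, iSup_adj, not_exists]
      exact fun k ↦ h k _ he
  rw [measureReal_def, unionBinomialRandom, Measure.map_apply (measurable_iSup_graph m)
    (measurableSet_of_finite_vertices _), hpre, Measure.pi_pi]
  simp only [binomialRandom_avoids p E hE, Finset.prod_const, Finset.card_univ, Fintype.card_fin,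
    ENNReal.toReal_pow]
  rw [← pow_mul, ← pow_mul, mul_comm]
  simp

end Avoidance

/-! ### Cuts, isolated sets and small closed sets -/

section Cuts

variable {V : Type*} [DecidableEq V]

/-- The potential edges with both endpoints in `S`. -/
def innerEdges (S : Finset V) : Finset (Sym2 V) := S.offDiag.image fun x ↦ s(x.1, x.2)

lemma forall_mem_innerEdges {S : Finset V} {P : Sym2 V → Prop} :
    (∀ e ∈ innerEdges S, P e) ↔ ∀ u ∈ S, ∀ v ∈ S, u ≠ v → P s(u, v) := by
  simp only [innerEdges, Finset.forall_mem_image, Finset.mem_offDiag, Prod.forall]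
  grind

lemma not_isDiag_of_mem_innerEdges (S : Finset V) : ∀ e ∈ innerEdges S, ¬ e.IsDiag := by
  rw [forall_mem_innerEdges]
  intro u _ v _ huv
  simpa using huv

lemma card_innerEdges (S : Finset V) : (innerEdges S).card = S.card.choose 2 :=
  Sym2.card_image_offDiag S

variable [Fintype V]

/-- The potential edges with exactly one endpoint in `S`. -/
def cutEdges (S : Finset V) : Finset (Sym2 V) := (S ×ˢ Sᶜ).image fun x ↦ s(x.1, x.2)

lemma forall_mem_cutEdges {S : Finset V} {P : Sym2 V → Prop} :
    (∀ e ∈ cutEdges S, P e) ↔ ∀ u ∈ S, ∀ v ∉ S, P s(u, v) := by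
  simp only [cutEdges, Finset.forall_mem_image, Finset.mem_product, Finset.mem_compl, Prod.forall]
  grind

lemma not_isDiag_of_mem_cutEdges (S : Finset V) : ∀ e ∈ cutEdges S, ¬ e.IsDiag := by
  rw [forall_mem_cutEdges]
  rintro u hu v hv h
  rw [Sym2.mk_isDiag_iff] at h
  exact hv (h ▸ hu)

lemma card_cutEdges (S : Finset V) :
    (cutEdges S).card = S.card * (Fintype.card V - S.card) := by
  rw [cutEdges, Finset.card_image_of_injOn, Finset.card_product, Finset.card_compl]
  rintro ⟨a, b⟩ h ⟨c, d⟩ h' heq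
  simp only [Finset.coe_product, Set.mem_prod, Finset.mem_coe, Finset.mem_compl] at h h'
  simp only [Sym2.eq_iff] at heq
  grind

lemma disjoint_cutEdges_innerEdges (S : Finset V) : Disjoint (cutEdges S) (innerEdges S) := by
  rw [Finset.disjoint_left, forall_mem_cutEdges]
  intro u hu v hv
  simp only [innerEdges, Finset.mem_image, Finset.mem_offDiag, Prod.exists, not_exists]
  rintro a b ⟨h, h'⟩
  simp only [Sym2.eq_iff] at h'
  grind

lemma card_cutEdges_union_innerEdges (S : Finset V) :
    (cutEdges S ∪ innerEdges S).card =
      S.card * (Fintype.card V - S.card) + S.card.choose 2 := by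
  rw [Finset.card_union_of_disjoint (disjoint_cutEdges_innerEdges S), card_cutEdges,
    card_innerEdges]

lemma not_isDiag_of_mem_union (S : Finset V) :
    ∀ e ∈ cutEdges S ∪ innerEdges S, ¬ e.IsDiag := by
  intro e he
  rcases Finset.mem_union.1 he with h | h
  exacts [not_isDiag_of_mem_cutEdges S e h, not_isDiag_of_mem_innerEdges S e h]

/-- All vertices of `S` are isolated iff no edge meets `S`. -/
lemma avoids_cutEdges_union_innerEdges_iff (G : SimpleGraph V) (S : Finset V) :
    (∀ e ∈ cutEdges S ∪ innerEdges S, e ∉ G.edgeSet) ↔ ∀ u ∈ S, ∀ v, ¬ G.Adj u v := by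
  simp only [Finset.mem_union, or_imp, forall_and, forall_mem_cutEdges, forall_mem_innerEdges,
    mem_edgeSet]
  constructor
  · rintro ⟨h₁, h₂⟩ u hu v huv
    by_cases hv : v ∈ S
    exacts [h₂ u hu v hv huv.ne huv, h₁ u hu v hv huv]
  · exact fun h ↦ ⟨fun u hu v _ ↦ h u hu v, fun u hu v _ _ ↦ h u hu v⟩

/-- A disconnected graph without isolated vertices has a small closed set of at least two
vertices that spans an edge. -/
lemma exists_small_closed_set [Nonempty V] {G : SimpleGraph V} (hG : ¬ G.Connected)
    (hiso : ∀ u, ∃ v, G.Adj u v) :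
    ∃ S : Finset V, 2 ≤ S.card ∧ 2 * S.card ≤ Fintype.card V ∧
      (∀ e ∈ cutEdges S, e ∉ G.edgeSet) ∧ ¬ ∀ e ∈ innerEdges S, e ∉ G.edgeSet := by
  classical
  obtain ⟨S, hne, hcard, hcut⟩ : ∃ S : Finset V, S.Nonempty ∧ 2 * S.card ≤ Fintype.card V ∧
      ∀ u ∈ S, ∀ v ∉ S, ¬ G.Adj u v := by
    have hG' : ¬ G.Preconnected := fun h ↦ hG ⟨h⟩
    simp only [Preconnected, not_forall] at hG'
    obtain ⟨u, v, huv⟩ := hG'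
    set T : Finset V := Finset.univ.filter fun w ↦ G.Reachable u w with hT
    have hcut : ∀ a ∈ T, ∀ b ∉ T, ¬ G.Adj a b := by
      intro a ha b hb hab
      simp only [hT, Finset.mem_filter, Finset.mem_univ, true_and] at ha hb
      exact hb (ha.trans hab.reachable)
    have hsum := Finset.card_add_card_compl T
    -- No edge leaves a component or its complement; the smaller of the two has at most half of the
    -- vertices.
    rcases le_total T.card Tᶜ.card with h | h
    · exact ⟨T, ⟨u, by simp [hT]⟩, by omega, hcut⟩
    · refine ⟨Tᶜ, ⟨v, by simpa [hT] using huv⟩, by omega, fun a ha b hb hab ↦ ?_⟩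
      exact hcut b (by simpa using hb) a (by simpa using ha) hab.symm
  obtain ⟨u, hu⟩ := hne
  obtain ⟨v, huv⟩ := hiso u
  have hv : v ∈ S := by
    by_contra hv
    exact hcut u hu v hv huv
  refine ⟨S, Finset.one_lt_card.2 ⟨u, hu, v, hv, huv.ne⟩, hcard, ?_, fun h ↦ ?_⟩
  · rw [forall_mem_cutEdges]
    exact hcut
  · rw [forall_mem_innerEdges] at h
    exact h u hu v hv huv.ne huv

end Cuts

/-! ### Inclusion–exclusion and the union bound -/

section Probability

variable {V : Type*} [Fintype V] [DecidableEq V]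

lemma unionBinomialRandom_real_no_isolated (m : ℕ) (p : I) :
    (unionBinomialRandom V m p).real {G | ∀ u, ∃ v, G.Adj u v} =
      ∑ k ∈ Finset.range (Fintype.card V + 1), (-1 : ℝ) ^ k * ((Fintype.card V).choose k *
        ((1 - (p : ℝ)) ^ m) ^ (k * (Fintype.card V - k) + k.choose 2)) := by
  have hcompl : {G : SimpleGraph V | ∀ u, ∃ v, G.Adj u v} =
      (⋃ u ∈ (Finset.univ : Finset V), {G : SimpleGraph V | ∀ v, ¬ G.Adj u v})ᶜ := by
    ext G; simp
  rw [hcompl, probReal_compl_eq_one_sub (measurableSet_of_finite_vertices _),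
    measureReal_biUnion_eq_sum_powerset (fun _ _ ↦ measurableSet_of_finite_vertices _)
      (fun _ _ ↦ measure_ne_top _ _)]
  have hterm (T : Finset V) : (unionBinomialRandom V m p).real
      (⋂ u ∈ T, {G : SimpleGraph V | ∀ v, ¬ G.Adj u v}) =
        ((1 - (p : ℝ)) ^ m) ^ (T.card * (Fintype.card V - T.card) + T.card.choose 2) := by
    rw [← card_cutEdges_union_innerEdges, ← unionBinomialRandom_real_avoids m p _
      (not_isDiag_of_mem_union T)]
    congr 1
    ext G
    rw [Set.mem_ofPred_eq, avoids_cutEdges_union_innerEdges_iff]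
    simp
  simp only [hterm]
  have hsplit := Finset.sum_powerset_apply_card
    (fun k ↦ (-1 : ℝ) ^ k * ((1 - (p : ℝ)) ^ m) ^ (k * (Fintype.card V - k) + k.choose 2))
    (x := (Finset.univ : Finset V))
  rw [Finset.card_univ] at hsplit
  -- Inclusion–exclusion runs over nonempty sets; the empty set supplies the 1 of the complement.
  rw [← Finset.sum_filter_add_sum_filter_not _ (fun t : Finset V ↦ t.Nonempty)] at hsplit
  have hempty : (Finset.univ : Finset V).powerset.filter (fun t ↦ ¬ t.Nonempty) = {∅} := by
    ext t; simp
  rw [hempty, Finset.sum_singleton] at hsplit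
  simp only [nsmul_eq_mul] at hsplit
  have hre : ∑ k ∈ Finset.range (Fintype.card V + 1), (-1 : ℝ) ^ k * ((Fintype.card V).choose k *
        ((1 - (p : ℝ)) ^ m) ^ (k * (Fintype.card V - k) + k.choose 2)) =
      ∑ k ∈ Finset.range (Fintype.card V + 1), ((Fintype.card V).choose k : ℝ) * ((-1 : ℝ) ^ k *
        ((1 - (p : ℝ)) ^ m) ^ (k * (Fintype.card V - k) + k.choose 2)) :=
    Finset.sum_congr rfl fun _ _ ↦ by ring
  rw [hre, ← hsplit]
  simp [pow_succ, Finset.sum_neg_distrib, add_comm]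

/-- The factor 1 - q^C(k,2), the probability that the closed set spans an edge, is essential:
without it the k-th term would tend to e^{-ck}/k!, since sets of isolated vertices would be counted.
-/
lemma unionBinomialRandom_real_disconnected_le [Nonempty V] (m : ℕ) (p : I) :
    (unionBinomialRandom V m p).real {G | (∀ u, ∃ v, G.Adj u v) ∧ ¬ G.Connected} ≤
      ∑ k ∈ Finset.range (Fintype.card V + 1) with 2 ≤ k ∧ 2 * k ≤ Fintype.card V,
        ((Fintype.card V).choose k : ℝ) *
        (((1 - (p : ℝ)) ^ m) ^ (k * (Fintype.card V - k)) *
          (1 - ((1 - (p : ℝ)) ^ m) ^ (k.choose 2))) := by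
  set q := (1 - (p : ℝ)) ^ m with hq
  set N := Fintype.card V with hN
  let A (S : Finset V) : Set (SimpleGraph V) := {G | ∀ e ∈ cutEdges S, e ∉ G.edgeSet}
  let B (S : Finset V) : Set (SimpleGraph V) :=
    {G | ∀ e ∈ cutEdges S ∪ innerEdges S, e ∉ G.edgeSet}
  have hBA (S : Finset V) : B S ⊆ A S := fun G h e he ↦ h e (Finset.mem_union_left _ he)
  have hsub : {G : SimpleGraph V | (∀ u, ∃ v, G.Adj u v) ∧ ¬ G.Connected} ⊆
      ⋃ S ∈ (Finset.univ : Finset (Finset V)).filter (fun S ↦ 2 ≤ S.card ∧ 2 * S.card ≤ N),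
        A S \ B S := by
    rintro G ⟨h₁, h₂⟩
    obtain ⟨S, h2, hS, hcut, hin⟩ := exists_small_closed_set h₂ h₁
    simp only [Set.mem_iUnion, Finset.mem_filter, Finset.mem_univ, true_and]
    exact ⟨S, ⟨h2, hS⟩, hcut, fun h ↦ hin fun e he ↦ h e (Finset.mem_union_right _ he)⟩
  have hterm (S : Finset V) : (unionBinomialRandom V m p).real (A S \ B S) =
      q ^ (S.card * (N - S.card)) * (1 - q ^ (S.card.choose 2)) := by
    rw [measureReal_sdiff (hBA S) (measurableSet_of_finite_vertices _),
      unionBinomialRandom_real_avoids m p _ (not_isDiag_of_mem_cutEdges S),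
      unionBinomialRandom_real_avoids m p _ (not_isDiag_of_mem_union S),
      card_cutEdges, card_cutEdges_union_innerEdges, pow_add]
    ring
  calc _ ≤ _ := measureReal_mono hsub (measure_ne_top _ _)
    _ ≤ _ := measureReal_biUnion_finset_le _ _
    _ = ∑ S ∈ (Finset.univ : Finset V).powerset, if 2 ≤ S.card ∧ 2 * S.card ≤ N then
          q ^ (S.card * (N - S.card)) * (1 - q ^ (S.card.choose 2)) else 0 := by
      simp only [hterm, Finset.powerset_univ, Finset.sum_filter]
    _ = _ := by
      rw [Finset.sum_powerset_apply_card (fun k ↦ if 2 ≤ k ∧ 2 * k ≤ N then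
          q ^ (k * (N - k)) * (1 - q ^ (k.choose 2)) else 0), Finset.card_univ,
        Finset.sum_filter]
      refine Finset.sum_congr rfl fun k _ ↦ ?_
      split_ifs <;> simp [← hN]

end Probability

/-! ### Asymptotics of q and of single terms -/

section Asymptotics

lemma tendsto_log_add_pow_div (c : ℝ) (k : ℕ) :
    Tendsto (fun n : ℕ ↦ (Real.log n + c) ^ k / (n : ℝ)) atTop (𝓝 0) := by
  have h : (fun x : ℝ ↦ (Real.log x + c) ^ k) =o[atTop] id := by
    have h₁ : (fun x : ℝ ↦ (Real.log x + c) ^ k) =O[atTop] fun x ↦ Real.log x ^ k := by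
      refine Asymptotics.IsBigO.pow ?_ k
      exact (Asymptotics.isBigO_refl _ _).add
        (Asymptotics.isLittleO_const_left.2 (.inr (tendsto_norm_atTop_atTop.comp
          Real.tendsto_log_atTop))).isBigO
    exact h₁.trans_isLittleO Real.isLittleO_pow_log_id_atTop
  exact h.tendsto_div_nhds_zero.comp tendsto_natCast_atTop_atTop

lemma one_sub_pow_le_exp {c : ℝ} {m n : ℕ} {p : I} (hm : 1 ≤ m) (hn : 1 ≤ n)
    (hp : (p : ℝ) = (Real.log n + c) / (m * n)) :
    (1 - (p : ℝ)) ^ m ≤ Real.exp (-((Real.log n + c) / n)) := by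
  have hm' : (0 : ℝ) < m := by exact_mod_cast hm
  have hn' : (0 : ℝ) < n := by exact_mod_cast hn
  calc (1 - (p : ℝ)) ^ m ≤ Real.exp (-p) ^ m :=
        pow_le_pow_left₀ (sub_nonneg.2 p.2.2) (Real.one_sub_le_exp_neg _) m
    _ = _ := by
      rw [← Real.exp_nat_mul, hp]
      congr 1
      field_simp

lemma exp_le_one_sub_pow {c : ℝ} {m n : ℕ} {p : I} (hm : 1 ≤ m) (hn : 1 ≤ n) (hp1 : (p : ℝ) < 1)
    (hp : (p : ℝ) = (Real.log n + c) / (m * n)) :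
    Real.exp (-((Real.log n + c) / n / (1 - p))) ≤ (1 - (p : ℝ)) ^ m := by
  have hm' : (0 : ℝ) < m := by exact_mod_cast hm
  have hn' : (0 : ℝ) < n := by exact_mod_cast hn
  have h0 : (0 : ℝ) < 1 - p := sub_pos.2 hp1
  have hlog : -(p / (1 - p) : ℝ) ≤ Real.log (1 - p) := by
    refine le_trans (le_of_eq ?_) (Real.one_sub_inv_le_log_of_pos h0)
    field_simp
    ring
  have hmp : (Real.log n + c) / n = m * p := by rw [hp]; field_simp
  calc Real.exp (-((Real.log n + c) / n / (1 - p))) = Real.exp (-(p / (1 - p))) ^ m := by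
        rw [← Real.exp_nat_mul, hmp]
        congr 1
        ring
    _ ≤ (1 - (p : ℝ)) ^ m := by
        refine pow_le_pow_left₀ (Real.exp_pos _).le ?_ m
        rwa [← Real.le_log_iff_exp_le h0]

variable {c : ℝ} {m : ℕ → ℕ} {p : ℕ → I}

lemma coe_le_log_add_div (hm : ∀ n, 1 ≤ m n)
    (hp : ∀ᶠ n : ℕ in atTop, (p n : ℝ) = (Real.log n + c) / (m n * n)) :
    ∀ᶠ n : ℕ in atTop, (p n : ℝ) ≤ (Real.log n + c) / n ∧ 0 ≤ Real.log n + c := by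
  filter_upwards [hp, eventually_ge_atTop 1] with n hn h1
  have hm' : (1 : ℝ) ≤ m n := by exact_mod_cast hm n
  have hn' : (0 : ℝ) < n := by exact_mod_cast h1
  have hmp : (Real.log n + c) / n = m n * p n := by rw [hn]; field_simp
  have h0 : (0 : ℝ) ≤ p n := (p n).2.1
  refine ⟨by rw [hmp]; nlinarith, ?_⟩
  have : 0 ≤ (Real.log n + c) / n := by rw [hmp]; positivity
  simpa [hn'.ne'] using mul_nonneg this hn'.le

lemma tendsto_coe_zero (hm : ∀ n, 1 ≤ m n)
    (hp : ∀ᶠ n : ℕ in atTop, (p n : ℝ) = (Real.log n + c) / (m n * n)) :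
    Tendsto (fun n ↦ (p n : ℝ)) atTop (𝓝 0) := by
  refine tendsto_of_tendsto_of_tendsto_of_le_of_le' tendsto_const_nhds
    (by simpa using tendsto_log_add_pow_div c 1) (.of_forall fun n ↦ (p n).2.1) ?_
  filter_upwards [coe_le_log_add_div hm hp] with n hn using hn.1

/-- The probability that a given edge is absent from the union tends to one. -/
lemma tendsto_one_sub_pow (hm : ∀ n, 1 ≤ m n)
    (hp : ∀ᶠ n : ℕ in atTop, (p n : ℝ) = (Real.log n + c) / (m n * n)) :
    Tendsto (fun n ↦ (1 - (p n : ℝ)) ^ m n) atTop (𝓝 1) := by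
  have hp0 := tendsto_coe_zero hm hp
  have hL : Tendsto (fun n : ℕ ↦ (Real.log n + c) / (n : ℝ)) atTop (𝓝 0) := by
    simpa using tendsto_log_add_pow_div c 1
  have hlow : Tendsto (fun n : ℕ ↦ Real.exp (-((Real.log n + c) / n / (1 - p n)))) atTop
      (𝓝 1) := by
    have := (hL.div (hp0.const_sub 1) (by norm_num)).neg.rexp
    simpa using this
  refine tendsto_of_tendsto_of_tendsto_of_le_of_le' hlow tendsto_const_nhds ?_ ?_
  · filter_upwards [hp, eventually_ge_atTop 1, hp0.eventually_lt_const zero_lt_one] with n h h1 hlt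
    exact exp_le_one_sub_pow (hm n) h1 hlt h
  · exact .of_forall fun n ↦ pow_le_one₀ (sub_nonneg.2 (p n).2.2) (by linarith [(p n).2.1])

/-- The expected number of isolated vertices tends to `exp (-c)`. -/
lemma tendsto_mul_one_sub_pow_pow (hm : ∀ n, 1 ≤ m n)
    (hp : ∀ᶠ n : ℕ in atTop, (p n : ℝ) = (Real.log n + c) / (m n * n)) :
    Tendsto (fun n : ℕ ↦ n * ((1 - (p n : ℝ)) ^ m n) ^ n) atTop (𝓝 (Real.exp (-c))) := by
  have hp0 := tendsto_coe_zero hm hp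
  -- Divided by 1 - p, this is the exponent lost in the lower bound for n q^n. It is eventually at
  -- most (log n + c)^2 / n.
  have hLp : Tendsto (fun n : ℕ ↦ (Real.log n + c) * (p n : ℝ)) atTop (𝓝 0) := by
    refine tendsto_of_tendsto_of_tendsto_of_le_of_le' tendsto_const_nhds
      (tendsto_log_add_pow_div c 2) ?_ ?_
    · filter_upwards [coe_le_log_add_div hm hp] with n hn using mul_nonneg hn.2 (p n).2.1
    · filter_upwards [coe_le_log_add_div hm hp] with n hn
      rw [pow_two, mul_div_assoc]
      exact mul_le_mul_of_nonneg_left hn.1 hn.2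
  have hlow : Tendsto (fun n : ℕ ↦ Real.exp (-c - (Real.log n + c) * p n / (1 - p n))) atTop
      (𝓝 (Real.exp (-c))) := by
    have := ((hLp.div (hp0.const_sub 1) (by norm_num)).const_sub (-c)).rexp
    simpa using this
  refine tendsto_of_tendsto_of_tendsto_of_le_of_le' hlow tendsto_const_nhds ?_ ?_
  · filter_upwards [hp, eventually_ge_atTop 1, hp0.eventually_lt_const zero_lt_one] with n h h1 hlt
    have hn' : (0 : ℝ) < n := by exact_mod_cast h1
    have h0 : (0 : ℝ) < 1 - p n := sub_pos.2 hlt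
    calc Real.exp (-c - (Real.log n + c) * p n / (1 - p n))
        = n * Real.exp (-((Real.log n + c) / n / (1 - p n))) ^ n := by
          rw [← Real.exp_nat_mul]
          nth_rw 2 [← Real.exp_log hn']
          rw [← Real.exp_add]
          congr 1
          field_simp
          ring
      _ ≤ _ := by
          gcongr
          exact exp_le_one_sub_pow (hm n) h1 hlt h
  · filter_upwards [hp, eventually_ge_atTop 1] with n h h1
    have hn' : (0 : ℝ) < n := by exact_mod_cast h1
    calc _ ≤ n * Real.exp (-((Real.log n + c) / n)) ^ n := by
          have : (0 : ℝ) ≤ 1 - p n := sub_nonneg.2 (p n).2.2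
          gcongr
          exact one_sub_pow_le_exp (hm n) h1 h
      _ = Real.exp (-c) := by
          rw [← Real.exp_nat_mul]
          nth_rw 1 [← Real.exp_log hn']
          rw [← Real.exp_add]
          congr 1
          field_simp
          ring

/-- This is the Poisson limit of C(n,k) (q^n)^k, because nk = k(n-k) + k^2 and q^(k^2) → 1. -/
lemma tendsto_choose_mul_pow_cut {q : ℕ → ℝ} {r : ℝ} (hq : Tendsto q atTop (𝓝 1))
    (hr : Tendsto (fun n : ℕ ↦ n * q n ^ n) atTop (𝓝 r)) (k : ℕ) :
    Tendsto (fun n : ℕ ↦ (n.choose k : ℝ) * q n ^ (k * (n - k))) atTop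
      (𝓝 (r ^ k / k.factorial)) := by
  have h := (tendsto_choose_mul_pow_atTop k hr).div (hq.pow (k ^ 2)) (by simp)
  rw [one_pow, div_one] at h
  refine h.congr' ?_
  filter_upwards [eventually_ge_atTop k, hq.eventually_ne one_ne_zero] with n hn h0
  have : n * k = k * (n - k) + k ^ 2 := by
    obtain ⟨j, rfl⟩ := Nat.exists_eq_add_of_le hn
    rw [Nat.add_sub_cancel_left]
    ring
  simp only [Pi.div_apply]
  rw [← pow_mul, this, pow_add]
  field_simp

end Asymptotics

/-! ### A summable bound uniform in n -/

section Domination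

/-- Since log x / x decreases beyond e, log n / n ≤ log(2d) / (2d) when 3 ≤ 2d ≤ n; this gives the
coefficient 1/2. The constant 3/2 absorbs the cases 2d < 3 and n < 2d ≤ n + 1. -/
lemma mul_log_div_le {n d : ℝ} (hn : 1 ≤ n) (hd : 1 ≤ 2 * d) (hdn : 2 * d ≤ n + 1) :
    d * Real.log n / n ≤ 3 / 2 + Real.log (2 * d) / 2 := by
  have hn0 : 0 < n := by linarith
  have hd0 : 0 < d := by linarith
  have hlog0 : 0 ≤ Real.log (2 * d) := Real.log_nonneg hd
  have hlogn : 0 ≤ Real.log n := Real.log_nonneg hn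
  have hdiv : Real.log n / n ≤ 1 := by
    rw [div_le_one hn0]
    linarith [Real.log_le_sub_one_of_pos hn0]
  have hdiv0 : 0 ≤ Real.log n / n := by positivity
  rw [mul_div_assoc]
  rcases lt_or_ge (2 * d) 3 with h3 | h3
  · nlinarith
  rcases le_or_gt (2 * d) n with hle | hlt
  · have he : Real.exp 1 ≤ 2 * d := by linarith [Real.exp_one_lt_d9]
    have := Real.log_div_self_antitoneOn he (he.trans hle) hle
    calc d * (Real.log n / n) ≤ d * (Real.log (2 * d) / (2 * d)) := by gcongr
      _ = Real.log (2 * d) / 2 := by field_simp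
      _ ≤ _ := by linarith
  · have hmono : Real.log n ≤ Real.log (2 * d) := Real.log_le_log hn0 hlt.le
    have : d * (Real.log n / n) ≤ (n + 1) / 2 * (Real.log n / n) := by
      gcongr
      linarith
    have h2 : (n + 1) / 2 * (Real.log n / n) = Real.log n / 2 + Real.log n / n / 2 := by
      field_simp
    linarith

/-- One term of the exponential series gives (2k)^k / k! ≤ e^{2k}; take logarithms. -/
lemma mul_log_two_mul_le (k : ℕ) (hk : 1 ≤ k) :
    k * Real.log (2 * k) ≤ 2 * k + Real.log k.factorial := by
  have hk0 : (0 : ℝ) < k := by exact_mod_cast hk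
  have h := Real.pow_div_factorial_le_exp (x := 2 * k) (by positivity) k
  have hf : (0 : ℝ) < k.factorial := by exact_mod_cast k.factorial_pos
  have := Real.log_le_log (by positivity) h
  rw [Real.log_div (by positivity) hf.ne', Real.log_pow, Real.log_exp] at this
  linarith

/-- The parameter d serves both sums: d = k for cuts, d = (k+1)/2 for isolated sets. The k log n
from C(n,k) ≤ n^k / k! cancels against q^e, leaving k d log n / n ≤ 3k/2 + k log(2k)/2 ≤ 5k/2 +
log(k!)/2. This uses up only half of the log k! available. -/
lemma choose_mul_pow_le {c q d : ℝ} {n k e : ℕ} (hq0 : 0 ≤ q)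
    (hq : q ≤ Real.exp (-((Real.log n + c) / n))) (hk : 1 ≤ k) (hkn : k ≤ n)
    (he : (e : ℝ) = k * (n - d)) (hd : 1 ≤ 2 * d) (hdk : d ≤ k) (hdn : 2 * d ≤ n + 1) :
    n.choose k * q ^ e ≤ Real.exp (k * (|c| + 5 / 2) - Real.log k.factorial / 2) := by
  have hk0 : (0 : ℝ) < k := by exact_mod_cast hk
  have hn1 : (1 : ℝ) ≤ n := by exact_mod_cast hk.trans hkn
  have hn0 : (0 : ℝ) < n := by linarith
  have hf : (0 : ℝ) < k.factorial := by exact_mod_cast k.factorial_pos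
  have hchoose : (n.choose k : ℝ) ≤ Real.exp (k * Real.log n - Real.log k.factorial) := by
    rw [Real.exp_sub, Real.exp_log hf, Real.exp_nat_mul, Real.exp_log hn0]
    exact Nat.choose_le_pow_div k n
  have hpow : q ^ e ≤ Real.exp (e * -((Real.log n + c) / n)) := by
    rw [Real.exp_nat_mul]
    exact pow_le_pow_left₀ hq0 hq e
  have hlog2 : Real.log (2 * d) ≤ Real.log (2 * k) := Real.log_le_log (by linarith) (by linarith)
  have hc : -(c * (1 - d / n)) ≤ |c| := by
    have h1 : d / n ≤ 1 := by rw [div_le_one hn0]; linarith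
    have h2 : 0 ≤ d / n := div_nonneg (by linarith) hn0.le
    have h3 : |c| * (1 - d / n) ≤ |c| := mul_le_of_le_one_right (abs_nonneg c) (by linarith)
    have h4 : -c * (1 - d / n) ≤ |c| * (1 - d / n) :=
      mul_le_mul_of_nonneg_right (neg_le_abs c) (by linarith)
    linarith
  have hexp : (e : ℝ) * -((Real.log n + c) / n) =
      k * (-Real.log n + d * Real.log n / n + -(c * (1 - d / n))) := by
    rw [he]
    field_simp
    ring
  have hkey : (k : ℝ) * (-Real.log n + d * Real.log n / n + -(c * (1 - d / n))) ≤
      k * (-Real.log n + (3 / 2 + Real.log (2 * k) / 2) + |c|) := by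
    have := mul_log_div_le hn1 hd hdn
    gcongr
    linarith
  have hfac := mul_log_two_mul_le k hk
  calc (n.choose k : ℝ) * q ^ e
      ≤ Real.exp (k * Real.log n - Real.log k.factorial) *
          Real.exp (e * -((Real.log n + c) / n)) := by gcongr
    _ ≤ _ := by
      rw [← Real.exp_add, Real.exp_le_exp, hexp]
      linarith

lemma summable_exp_sub_log_factorial (D : ℝ) :
    Summable fun k : ℕ ↦ Real.exp (k * D - Real.log k.factorial / 2) := by
  refine summable_of_ratio_test_tendsto_lt_one (l := 0) zero_lt_one
    (.of_forall fun k ↦ (Real.exp_pos _).ne') ?_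
  have h : Tendsto (fun k : ℕ ↦ Real.exp (D - Real.log ((k + 1 : ℕ) : ℝ) / 2)) atTop (𝓝 0) := by
    refine Real.tendsto_exp_atBot.comp ?_
    refine tendsto_atBot_add_const_left _ D (tendsto_neg_atTop_atBot.comp ?_)
    exact (Real.tendsto_log_atTop.comp ((tendsto_natCast_atTop_atTop).comp
      (tendsto_add_atTop_nat 1))).atTop_div_const two_pos
  refine h.congr fun k ↦ ?_
  have hf : (k.factorial : ℝ) ≠ 0 := by exact_mod_cast k.factorial_ne_zero
  rw [Real.norm_of_nonneg (Real.exp_pos _).le, Real.norm_of_nonneg (Real.exp_pos _).le,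
    ← Real.exp_sub, Nat.factorial_succ, Nat.cast_mul,
    Real.log_mul (by positivity) hf]
  congr 1
  push_cast
  ring

end Domination

/-! ### Passing to the limit in the two sums -/

section Limits

variable {c : ℝ} {q : ℕ → ℝ}

lemma tendsto_isolated_sum (hq0 : ∀ n, 0 ≤ q n)
    (hq : ∀ᶠ n : ℕ in atTop, q n ≤ Real.exp (-((Real.log n + c) / n)))
    (hq1 : Tendsto q atTop (𝓝 1))
    (hr : Tendsto (fun n : ℕ ↦ n * q n ^ n) atTop (𝓝 (Real.exp (-c)))) :
    Tendsto (fun n : ℕ ↦ ∑ k ∈ Finset.range (n + 1),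
      (-1 : ℝ) ^ k * (n.choose k * q n ^ (k * (n - k) + k.choose 2))) atTop
      (𝓝 (Real.exp (-Real.exp (-c)))) := by
  have hsum (n : ℕ) : ∑ k ∈ Finset.range (n + 1),
      (-1 : ℝ) ^ k * (n.choose k * q n ^ (k * (n - k) + k.choose 2)) =
      ∑' k, (-1 : ℝ) ^ k * (n.choose k * q n ^ (k * (n - k) + k.choose 2)) := by
    refine (tsum_eq_sum fun k hk ↦ ?_).symm
    rw [Finset.mem_range, not_lt] at hk
    simp [Nat.choose_eq_zero_of_lt (Nat.lt_of_succ_le hk)]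
  have hlim : Real.exp (-Real.exp (-c)) =
      ∑' k : ℕ, (-1 : ℝ) ^ k * (Real.exp (-c) ^ k / k.factorial) := by
    rw [Real.exp_eq_exp_ℝ, NormedSpace.exp_eq_tsum_div]
    refine tsum_congr fun k ↦ ?_
    rw [neg_pow, mul_div_assoc]
  rw [hlim]
  simp only [hsum]
  refine tendsto_tsum_of_dominated_convergence
    (summable_exp_sub_log_factorial (|c| + 5 / 2)) (fun k ↦ ?_) ?_
  · have := ((tendsto_choose_mul_pow_cut hq1 hr k).mul (hq1.pow (k.choose 2))).const_mul
      ((-1 : ℝ) ^ k)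
    rw [one_pow, mul_one] at this
    refine this.congr fun n ↦ ?_
    rw [pow_add]
    ring
  · filter_upwards [hq] with n hn k
    rw [norm_mul, norm_pow, norm_neg, norm_one, one_pow, one_mul,
      Real.norm_of_nonneg (mul_nonneg (Nat.cast_nonneg _) (pow_nonneg (hq0 n) _))]
    rcases lt_or_ge n k with hnk | hkn
    · simpa [Nat.choose_eq_zero_of_lt hnk] using (Real.exp_pos _).le
    rcases Nat.eq_zero_or_pos k with rfl | hk
    · simp
    have hk1 : (1 : ℝ) ≤ k := by exact_mod_cast hk
    have hkn' : (k : ℝ) ≤ n := by exact_mod_cast hkn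
    -- Here k(n-k) + C(k,2) = k(n - (k+1)/2); the case k = n is why the bound allows 2d = n + 1.
    refine choose_mul_pow_le (d := (k + 1) / 2) (hq0 n) hn hk hkn ?_ ?_ ?_ ?_
    · push_cast [Nat.cast_choose_two, Nat.cast_sub hkn]
      ring
    all_goals linarith

lemma tendsto_cut_sum (hq0 : ∀ n, 0 ≤ q n) (hqle : ∀ n, q n ≤ 1)
    (hq : ∀ᶠ n : ℕ in atTop, q n ≤ Real.exp (-((Real.log n + c) / n)))
    (hq1 : Tendsto q atTop (𝓝 1))
    (hr : Tendsto (fun n : ℕ ↦ n * q n ^ n) atTop (𝓝 (Real.exp (-c)))) :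
    Tendsto (fun n : ℕ ↦ ∑ k ∈ Finset.range (n + 1) with 2 ≤ k ∧ 2 * k ≤ n,
      (n.choose k : ℝ) * (q n ^ (k * (n - k)) * (1 - q n ^ k.choose 2))) atTop (𝓝 0) := by
  have hsum (n : ℕ) : ∑ k ∈ Finset.range (n + 1) with 2 ≤ k ∧ 2 * k ≤ n,
      (n.choose k : ℝ) * (q n ^ (k * (n - k)) * (1 - q n ^ k.choose 2)) =
      ∑' k : ℕ, if 2 ≤ k ∧ 2 * k ≤ n then
        (n.choose k : ℝ) * (q n ^ (k * (n - k)) * (1 - q n ^ k.choose 2)) else 0 := by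
    rw [Finset.sum_filter]
    refine (tsum_eq_sum fun k hk ↦ ?_).symm
    rw [Finset.mem_range, not_lt] at hk
    exact if_neg (by omega)
  have hnn (n k : ℕ) : 0 ≤ 1 - q n ^ k.choose 2 :=
    sub_nonneg.2 (pow_le_one₀ (hq0 n) (hqle n))
  have hle1 (n k : ℕ) : 1 - q n ^ k.choose 2 ≤ 1 := by
    linarith [pow_nonneg (hq0 n) (k.choose 2)]
  have hpos (n k : ℕ) :
      0 ≤ (n.choose k : ℝ) * (q n ^ (k * (n - k)) * (1 - q n ^ k.choose 2)) :=
    mul_nonneg (Nat.cast_nonneg _) (mul_nonneg (pow_nonneg (hq0 n) _) (hnn n k))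
  simp only [hsum]
  have hzero : 𝓝 (0 : ℝ) = 𝓝 (∑' _ : ℕ, 0) := by rw [tsum_zero]
  rw [hzero]
  refine tendsto_tsum_of_dominated_convergence
    (summable_exp_sub_log_factorial (|c| + 5 / 2)) (fun k ↦ ?_) ?_
  · have := (tendsto_choose_mul_pow_cut hq1 hr k).mul ((hq1.pow (k.choose 2)).const_sub 1)
    rw [one_pow, sub_self, mul_zero] at this
    refine squeeze_zero (fun n ↦ ?_) (fun n ↦ ?_) this
    · split_ifs
      exacts [hpos n k, le_rfl]
    · rw [mul_assoc]
      split_ifs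
      exacts [le_rfl, hpos n k]
  · filter_upwards [hq] with n hn k
    split_ifs with h
    · rw [Real.norm_of_nonneg (hpos n k), ← mul_assoc]
      have hk1 : (2 : ℝ) ≤ k := by exact_mod_cast h.1
      have hkn' : 2 * (k : ℝ) ≤ n := by exact_mod_cast h.2
      refine (mul_le_of_le_one_right (mul_nonneg (Nat.cast_nonneg _) (pow_nonneg (hq0 n) _))
        (hle1 n k)).trans ?_
      refine choose_mul_pow_le (d := k) (hq0 n) hn (by omega) (by omega) ?_ ?_ ?_ ?_
      · push_cast [Nat.cast_sub (show k ≤ n by omega)]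
        ring
      all_goals linarith
    · simpa using (Real.exp_pos _).le

end Limits

end SimpleGraph

theorem mainTheorem3 (c : ℝ) (m : ℕ → ℕ) (hm : ∀ n, 1 ≤ m n) (p : ℕ → I)
    (hp : ∀ᶠ n : ℕ in atTop, (p n : ℝ) = (Real.log n + c) / (m n * n)) :
    Tendsto
      (fun n : ℕ ↦ (SimpleGraph.unionBinomialRandom (Fin n) (m n) (p n)).real
        {G : SimpleGraph (Fin n) | G.Connected})
      atTop (𝓝 (Real.exp (-Real.exp (-c)))) := by
  set q : ℕ → ℝ := fun n ↦ (1 - (p n : ℝ)) ^ m n with hqdef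
  have hq0 (n : ℕ) : 0 ≤ q n := pow_nonneg (sub_nonneg.2 (p n).2.2) _
  have hqle (n : ℕ) : q n ≤ 1 :=
    pow_le_one₀ (sub_nonneg.2 (p n).2.2) (by linarith [(p n).2.1])
  have hq : ∀ᶠ n : ℕ in atTop, q n ≤ Real.exp (-((Real.log n + c) / n)) := by
    filter_upwards [hp, eventually_ge_atTop 1] with n h h1
    exact SimpleGraph.one_sub_pow_le_exp (hm n) h1 h
  have hq1 := SimpleGraph.tendsto_one_sub_pow hm hp
  have hr := SimpleGraph.tendsto_mul_one_sub_pow_pow hm hp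
  have hiso := SimpleGraph.tendsto_isolated_sum hq0 hq hq1 hr
  have hcut := SimpleGraph.tendsto_cut_sum hq0 hqle hq hq1 hr
  have hdisc : Tendsto (fun n : ℕ ↦ (SimpleGraph.unionBinomialRandom (Fin n) (m n) (p n)).real
      {G | (∀ u, ∃ v, G.Adj u v) ∧ ¬ G.Connected}) atTop (𝓝 0) := by
    refine tendsto_of_tendsto_of_tendsto_of_le_of_le' tendsto_const_nhds hcut
      (.of_forall fun n ↦ measureReal_nonneg) ?_
    filter_upwards [eventually_ge_atTop 1] with n hn
    have : NeZero n := ⟨by omega⟩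
    simpa only [Fintype.card_fin] using
      SimpleGraph.unionBinomialRandom_real_disconnected_le (V := Fin n) (m n) (p n)
  have hdiff := hiso.sub hdisc
  rw [sub_zero] at hdiff
  refine hdiff.congr' ?_
  -- For n = 1 the graph is connected although its vertex is isolated.
  filter_upwards [eventually_ge_atTop 2] with n hn
  have : Nontrivial (Fin n) := Fin.nontrivial_iff_two_le.2 hn
  have hnoiso := SimpleGraph.unionBinomialRandom_real_no_isolated (V := Fin n) (m n) (p n)
  rw [Fintype.card_fin] at hnoiso
  have hsplit := measureReal_sdiff (μ := SimpleGraph.unionBinomialRandom (Fin n) (m n) (p n))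
    (s₁ := {G | ∀ u, ∃ v, G.Adj u v}) (s₂ := {G | (∀ u, ∃ v, G.Adj u v) ∧ ¬ G.Connected})
    (fun G hG ↦ hG.1) (SimpleGraph.measurableSet_of_finite_vertices _)
  rw [← hnoiso, ← hsplit]
  congr 1
  ext G
  simp only [Set.mem_sdiff, Set.mem_ofPred_eq, not_and, not_not]
  exact ⟨fun h ↦ h.2 h.1, fun h ↦ ⟨h.preconnected.exists_adj_of_nontrivial, fun _ ↦ h⟩⟩
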